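/- **Definitions.** An isofibration of quasi-categories is a map with the right lifting property against the inner horn inclusions and both endpoint inclusions $\Delta^0 \to \mathbb{I}$, where $\mathbb{I}$ is the nerve of the free-living isomorphism. A map $f\colon X \to Y$ of quasi-categories is an equivalence if there are $g \colon Y \to X$ and homotopies $X \times \mathbb{I} \to X$ from $\mathrm{id}_X$ to $gf$ and $Y \times \mathbb{I} \to Y$ from $fg$ to $\mathrm{id}_Y$. An *$\infty$-cosmos* is a simplicially enriched category $\mathcal{K}$ whose homs $\mathrm{Fun}(A,B)$ are quasi-categories, with a specified subcategory of isofibrations, such that: (a) $\mathcal{K}$ has, in the simplicially enriched sense, a terminal object $1$, cotensors $A^U$ of objects $A$ by all simplicial sets $U$, and pullbacks of isofibrations along arbitrary functors; (b) isofibrations contain the isomorphisms and all $A \to 1$ and are stable under pullback; for an isofibration $p\colon E \to B$ and a monomorphism $i \colon U \to V$ of simplicial sets the map $E^V \to E^U\times_{B^U} B^V$ is an isofibration; and $\mathrm{Fun}(X,p)$ is an isofibration of quasi-categories for every $X$; (c) every object has the left lifting property against every isofibration $p$ such that $\mathrm{Fun}(X,p)$ is an equivalence of quasi-categories for all $X$.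 The *homotopy 2-category* $\mathcal{K}_2$ has the objects and morphisms ("functors") of $\mathcal{K}$ as objects and 1-cells, and its hom-category from $A$ to $B$ is the homotopy category of $\mathrm{Fun}(A,B)$. Adjunctions $f \dashv u$ and equivalences $A \simeq B$ are taken in the 2-category $\mathcal{K}_2$. For a simplicial set $J$, let $\Delta \colon A \to A^J$ be the constant diagram functor. An element $\ell \colon 1 \to A$ is a *limit* of a diagram $d \colon 1 \to A^J$ if there is a 2-cell $\lambda \colon \Delta \ell \Rightarrow d$ such that for every $X$ (with unique functor $!\colon X \to 1$), every $b \colon X \to A$ and every 2-cell $\chi \colon \Delta b \Rightarrow d\,!$ there is a unique 2-cell $\zeta \colon b \Rightarrow \ell\, !$ with $\chi = \lambda ! \cdot \Delta\zeta$, that is, if $\lambda$ is an absolute right lifting of $d$ through $\Delta$; $\ell$ is a *colimit* of $d$ if dually some 2-cell $d \Rightarrow \Delta\ell$ is an absolute left lifting. A *functor of $\infty$-cosmoi* $F \colon \mathcal{K} \to \mathcal{L}$ is a simplicial functor that preserves isofibrations and the limits in (a). It is a *weak equivalence* if every object $X$ of $\mathcal{L}$ is equivalent to $FA$ for some $A \in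 \mathcal{K}$, and every map $\mathrm{Fun}(A,B) \to \mathrm{Fun}(FA,FB)$ is an equivalence of quasi-categories. Using the canonical isomorphisms $F1 \cong 1$ and $F(A^J)\cong (FA)^J$, an element $\ell\colon 1 \to A$ gives an element $F\ell \colon 1 \to FA$ and a diagram $d \colon 1 \to A^J$ gives a diagram $Fd \colon 1 \to (FA)^J$. **Theorem (model independence of basic category theory I).** Let $F\colon \mathcal{K} \to \mathcal{L}$ be a weak equivalence of $\infty$-cosmoi. 1. For functors $f \colon B \to A$ and $u \colon A \to B$ in $\mathcal{K}$: $f \dashv u$ if and only if $Ff \dashv Fu$. 2. A functor $u \colon A \to B$ in $\mathcal{K}$ has a left adjoint if and only if $Fu$ does, and has a right adjoint if and only if $Fu$ does. 3. For a simplicial set $J$, an object $A$ of $\mathcal{K}$, a diagram $d\colon 1 \to A^J$ and an element $\ell\colon 1 \to A$: $\ell$ is a limit (respectively a colimit) of $d$ if and only if $F\ell$ is a limit (respectively a colimit) of $Fd$. 4. A diagram $d \colon 1 \to A^J$ in $\mathcal{K}$ has a limit (respectively a colimit) if and only if $Fd \colon 1 \to (FA)^J$ does. -/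

import Mathlib

open CategoryTheory MonoidalCategory CartesianMonoidalCategory Limits Simplicial

universe v u u₁ u₂

noncomputable section

namespace Cosmos

/-! ### Quasi-categories: isofibrations and equivalences -/

/-- A map of simplicial sets is an isofibration if it has the right lifting property against the
inner horn inclusions and against the inclusion of either endpoint into the interval `𝕀`,
the nerve of the free-living isomorphism. -/
structure IsQCatIsofibration {X Y : SSet.{v}} (p : X ⟶ Y) : Prop where
  inner : SSet.innerFibrations p
  endpoint₀ : HasLiftingProperty
    (SSet.const SSet.coherentIso.x₀ : (Δ[0] : SSet.{v}) ⟶ SSet.coherentIso) p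
  endpoint₁ : HasLiftingProperty
    (SSet.const SSet.coherentIso.x₁ : (Δ[0] : SSet.{v}) ⟶ SSet.coherentIso) p

/-- `H : X × 𝕀 ⟶ Y` (equivalently, a map `X ⟶ Y^𝕀`) is a homotopy from `f` to `g`. -/
structure IsIsoHomotopy {X Y : SSet.{v}} (f g : X ⟶ Y) (H : X ⊗ SSet.coherentIso ⟶ Y) : Prop where
  source : lift (𝟙 X) (SSet.const SSet.coherentIso.x₀) ≫ H = f
  target : lift (𝟙 X) (SSet.const SSet.coherentIso.x₁) ≫ H = g

/-- A map of quasi-categories is an equivalence if it is a simplicial homotopy equivalence with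
respect to the interval `𝕀`. -/
def IsQCatEquivalence {X Y : SSet.{v}} (f : X ⟶ Y) : Prop :=
  ∃ g : Y ⟶ X, (∃ H, IsIsoHomotopy (𝟙 X) (f ≫ g) H) ∧ (∃ H, IsIsoHomotopy (g ≫ f) (𝟙 Y) H)

/-! ### Simplicial cotensors -/

section Cotensor

variable {K : Type u} [Category.{v} K] [SimplicialCategory K]

/-- The map `U × Fun(X, P) ⟶ Fun(X, A)` induced by a cone `U ⟶ Fun(P, A)` and composition. -/
def coneAction {U : SSet.{v}} {A P : K} (cone : U ⟶ P ⟶[SSet] A) (X : K) :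
    U ⊗ (X ⟶[SSet] P) ⟶ (X ⟶[SSet] A) :=
  cone ▷ _ ≫ (β_ _ _).hom ≫ eComp SSet X P A

/-- A cone `U ⟶ Fun(P, A)` exhibits `P` as the simplicial cotensor `A^U` if, for every `X`, the
induced map `Fun(X, P) ⟶ Fun(X, A)^U` is an isomorphism of simplicial sets. -/
def IsCotensor {U : SSet.{v}} {A P : K} (cone : U ⟶ P ⟶[SSet] A) : Prop :=
  ∀ X : K, IsIso (MonoidalClosed.curry (coneAction cone X))

variable (K) in
/-- All simplicial cotensors exist. -/
class HasCotensors : Prop where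
  exists_cotensor (A : K) (U : SSet.{v}) : ∃ (P : K) (cone : U ⟶ P ⟶[SSet] A), IsCotensor cone

/-- The functor `X ⟶ A^U` classified by a map `U ⟶ Fun(X, A)`, where `cone` exhibits `P` as
`A^U`. -/
def IsCotensor.lift {U : SSet.{v}} {A P : K} {cone : U ⟶ P ⟶[SSet] A} (h : IsCotensor cone)
    {X : K} (x : U ⟶ X ⟶[SSet] A) : X ⟶ P :=
  haveI := h X
  (eHomEquiv SSet).symm
    (MonoidalClosed.curry ((ρ_ U).hom ≫ x) ≫ inv (MonoidalClosed.curry (coneAction cone X)))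

variable [HasCotensors K]

/-- The `∞`-category `A^U` of `U`-indexed diagrams in `A`. -/
def cotensor (A : K) (U : SSet.{v}) : K :=
  (HasCotensors.exists_cotensor A U).choose

/-- The universal cone `U ⟶ Fun(A^U, A)`. -/
def cotensorCone (A : K) (U : SSet.{v}) : U ⟶ cotensor A U ⟶[SSet] A :=
  (HasCotensors.exists_cotensor A U).choose_spec.choose

lemma isCotensor_cotensorCone (A : K) (U : SSet.{v}) : IsCotensor (cotensorCone A U) :=
  (HasCotensors.exists_cotensor A U).choose_spec.choose_spec

/-- The functor `X ⟶ A^U` classified by a map `U ⟶ Fun(X, A)`. -/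
def cotensorLift {X A : K} {U : SSet.{v}} (x : U ⟶ X ⟶[SSet] A) : X ⟶ cotensor A U :=
  (isCotensor_cotensorCone A U).lift x

/-- The functor `p^U : E^U ⟶ B^U` induced by `p : E ⟶ B`. -/
def cotensorMap {E B : K} (p : E ⟶ B) (U : SSet.{v}) : cotensor E U ⟶ cotensor B U :=
  cotensorLift (cotensorCone E U ≫ eHomWhiskerLeft SSet _ p)

/-- The functor `A^i : A^V ⟶ A^U` induced by `i : U ⟶ V`. -/
def cotensorRestrict (A : K) {U V : SSet.{v}} (i : U ⟶ V) : cotensor A V ⟶ cotensor A U :=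
  cotensorLift (i ≫ cotensorCone A V)

/-- The constant diagram functor `Δ : A ⟶ A^J`. -/
def constDiagram (A : K) (J : SSet.{v}) : A ⟶ cotensor A J :=
  cotensorLift (toUnit J ≫ eId SSet A)

end Cotensor

/-! ### `∞`-cosmoi -/

section InfinityCosmos

variable (K : Type u) [Category.{v} K] [SimplicialCategory K]

/-- A functor `f : A ⟶ B` of a simplicial category is a (representably defined) equivalence if
`Fun(X, f)` is an equivalence of quasi-categories for all `X`. -/
def IsEquivalence {K : Type u} [Category.{v} K] [SimplicialCategory K] {A B : K} (f : A ⟶ B) :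
    Prop :=
  ∀ X : K, IsQCatEquivalence (eHomWhiskerLeft SSet X f)

/-- An `∞`-cosmos: a simplicial category whose homs are quasi-categories, with a specified
class of isofibrations. Limits (the terminal object, pullbacks of isofibrations, cotensors) are
required to exist in the simplicially enriched sense. -/
class InfinityCosmos where
  quasicategory_hom (A B : K) : SSet.Quasicategory (A ⟶[SSet] B)
  /-- The isofibrations. -/
  isofibration : MorphismProperty K
  isMultiplicative : isofibration.IsMultiplicative
  hasTerminal : Enriched.HasConicalTerminal SSet.{v} K
  hasCotensors : HasCotensors K
  hasPullback {E A B : K} (p : E ⟶ B) (f : A ⟶ B) :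
    isofibration p → Enriched.HasConicalPullback SSet.{v} p f
  isofibration_of_isIso {A B : K} (f : A ⟶ B) [IsIso f] : isofibration f
  isofibration_terminal (A : K) : isofibration (terminal.from A)
  isStableUnderBaseChange : isofibration.IsStableUnderBaseChange
  /-- Leibniz cotensors of monomorphisms `i : U ⟶ V` with isofibrations `p : E ⟶ B` are
  isofibrations: `Q` is the pullback of `p^U : E^U ⟶ B^U` and `B^i : B^V ⟶ B^U`, and `ℓ` is the
  induced functor `E^V ⟶ Q`. -/
  isofibration_leibniz {E B : K} (p : E ⟶ B) {U V : SSet.{v}} (i : U ⟶ V) [Mono i] {Q : K}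
    (fst : Q ⟶ cotensor E U) (snd : Q ⟶ cotensor B V) (ℓ : cotensor E V ⟶ Q) :
    isofibration p → IsPullback fst snd (cotensorMap p U) (cotensorRestrict B i) →
    ℓ ≫ fst = cotensorRestrict E i → ℓ ≫ snd = cotensorMap p V → isofibration ℓ
  isQCatIsofibration_hom (X : K) {E B : K} (p : E ⟶ B) :
    isofibration p → IsQCatIsofibration (eHomWhiskerLeft SSet X p)
  /-- All objects lift against trivial fibrations. -/
  cofibrant (A : K) {E B : K} (p : E ⟶ B) (b : A ⟶ B) :
    isofibration p → IsEquivalence p → ∃ e : A ⟶ E, e ≫ p = b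

attribute [instance] InfinityCosmos.hasTerminal InfinityCosmos.hasCotensors

end InfinityCosmos

/-! ### The homotopy 2-category, adjunctions, limits and colimits -/

section HomotopyTwoCategory

/-- The homotopy 2-category `K₂` of `K`: its objects and 1-cells are those of `K`, and its
hom-category from `A` to `B` is the homotopy category of `Fun(A, B)`. -/
abbrev HomotopyTwoCategory (K : Type u) : Type u :=
  CatEnrichedOrdinary (TransportEnrichment SSet.hoFunctor.{v} K)

variable {K : Type u} [Category.{v} K] [SimplicialCategory K]

instance catEnrichedOrdinaryCategory :
    EnrichedOrdinaryCategory Cat.{v, v} (TransportEnrichment SSet.hoFunctor.{v} K) :=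
  TransportEnrichment.enrichedOrdinaryCategory K SSet.hoFunctor.{v}
    (SSet.hoFunctor.unitHomEquiv · |>.trans <| Functor.equivCatHom _ _)
      (congrArg (Functor.toCatHom) <| SSet.hoFunctor.unitHomEquiv_eq · ·)

/-- An object of `K`, as an object of the homotopy 2-category. -/
def ho (A : K) : HomotopyTwoCategory.{v} K := A

/-- A morphism of `K`, as a 1-cell of the homotopy 2-category. -/
def hoMap {A B : K} (f : A ⟶ B) : ho A ⟶ ho B := f

/-- `A ≃ B`: equivalence of objects in the homotopy 2-category. -/
def AreEquivalent (A B : K) : Prop :=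
  Nonempty (Bicategory.Equivalence (ho.{v} A) (ho.{v} B))

/-- `f ⊣ u`: adjointness in the homotopy 2-category. -/
def IsAdjoint {A B : K} (f : B ⟶ A) (u : A ⟶ B) : Prop :=
  Nonempty (Bicategory.Adjunction (hoMap f) (hoMap u))

variable [InfinityCosmos K]

/-- The element `ℓ : 1 ⟶ A` is a limit of the diagram `d : 1 ⟶ A^J`: there is a 2-cell
`ℓ ≫ Δ ⟶ d` of the homotopy 2-category that is an absolute right lifting of `d` through
`Δ : A ⟶ A^J`. -/
def IsLimitElement {A : K} {J : SSet.{v}} (d : ⊤_ K ⟶ cotensor A J) (ℓ : ⊤_ K ⟶ A) : Prop :=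
  ∃ c : hoMap ℓ ≫ hoMap (constDiagram A J) ⟶ hoMap d,
    Nonempty (Bicategory.RightLift.IsAbsKan (Bicategory.RightLift.mk (hoMap ℓ) c))

/-- The element `ℓ : 1 ⟶ A` is a colimit of the diagram `d : 1 ⟶ A^J`: there is a 2-cell
`d ⟶ ℓ ≫ Δ` of the homotopy 2-category that is an absolute left lifting of `d` through
`Δ : A ⟶ A^J`. -/
def IsColimitElement {A : K} {J : SSet.{v}} (d : ⊤_ K ⟶ cotensor A J) (ℓ : ⊤_ K ⟶ A) : Prop :=
  ∃ c : hoMap d ⟶ hoMap ℓ ≫ hoMap (constDiagram A J),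
    Nonempty (Bicategory.LeftLift.IsAbsKan (Bicategory.LeftLift.mk (hoMap ℓ) c))

end HomotopyTwoCategory

/-! ### Functors and weak equivalences of `∞`-cosmoi -/

section Functors

/-- The underlying functor of a simplicial functor. -/
def underlying {K : Type u₁} [Category.{v} K] [SimplicialCategory K]
    {L : Type u₂} [Category.{v} L] [SimplicialCategory L] (F : EnrichedFunctor SSet.{v} K L) :
    K ⥤ L :=
  ForgetEnrichment.equivInverse SSet.{v} K ⋙ F.forget ⋙ ForgetEnrichment.equivFunctor SSet.{v} L

variable (K : Type u₁) [Category.{v} K] [SimplicialCategory K] [InfinityCosmos K]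
  (L : Type u₂) [Category.{v} L] [SimplicialCategory L] [InfinityCosmos L]

/-- A functor of `∞`-cosmoi: a simplicial functor that preserves isofibrations, the terminal
object, pullbacks of isofibrations and cotensors. (As these limits are enriched limits in `L`,
preservation by the underlying functor is preservation as enriched limits.) -/
structure CosmosFunctor extends EnrichedFunctor SSet.{v} K L where
  isofibration_map {E B : K} (p : E ⟶ B) :
    InfinityCosmos.isofibration p →
      InfinityCosmos.isofibration ((underlying toEnrichedFunctor).map p)
  preservesTerminal : PreservesLimit (Functor.empty.{0} K) (underlying toEnrichedFunctor)
  preservesPullback {E A B : K} (p : E ⟶ B) (f : A ⟶ B) :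
    InfinityCosmos.isofibration p → PreservesLimit (cospan p f) (underlying toEnrichedFunctor)
  preservesCotensor {U : SSet.{v}} {A P : K} (cone : U ⟶ P ⟶[SSet] A) :
    IsCotensor cone → IsCotensor (cone ≫ map P A)

variable {K L}

namespace CosmosFunctor

variable (F : CosmosFunctor K L)

/-- The underlying functor of a functor of `∞`-cosmoi. -/
def functor : K ⥤ L := underlying F.toEnrichedFunctor

instance : PreservesLimit (Functor.empty.{0} K) F.functor := F.preservesTerminal

/-- The image of an element `1 ⟶ A`: the composite `1 ≅ F 1 ⟶ F A`. -/
def mapElement {A : K} (a : ⊤_ K ⟶ A) : ⊤_ L ⟶ F.functor.obj A :=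
  (PreservesTerminal.iso F.functor).inv ≫ F.functor.map a

/-- The canonical functor `F (A^J) ⟶ (F A)^J` (an isomorphism, as `F` preserves cotensors). -/
def cotensorComparison (A : K) (J : SSet.{v}) :
    F.functor.obj (cotensor A J) ⟶ cotensor (F.functor.obj A) J :=
  cotensorLift (cotensorCone A J ≫ F.map (cotensor A J) A)

/-- The image of a diagram `1 ⟶ A^J`: the composite `1 ≅ F 1 ⟶ F (A^J) ≅ (F A)^J`. -/
def mapDiagram {A : K} {J : SSet.{v}} (d : ⊤_ K ⟶ cotensor A J) :
    ⊤_ L ⟶ cotensor (F.functor.obj A) J :=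
  F.mapElement d ≫ F.cotensorComparison A J

/-- A weak equivalence of `∞`-cosmoi: surjective on objects up to equivalence, and a local
equivalence of quasi-categories. -/
structure IsWeakEquivalence : Prop where
  surjective (X : L) : ∃ A : K, AreEquivalent (F.functor.obj A) X
  local_equivalence (A B : K) : IsQCatEquivalence (F.map A B)

end CosmosFunctor

end Functors

end Cosmos

end

/-!
A weak equivalence `F : K ⟶ L` of `∞`-cosmoi induces a biequivalence of homotopy 2-categories, and
every notion in the theorem is a 2-categorical notion that biequivalences preserve and reflect.

*The biequivalence.* The functor `SSet.hoFunctor` preserves products and inverts the interval, so it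
carries an equivalence of quasi-categories to an equivalence of categories
(`IsQCatEquivalence.isEquivalence_ho`). A simplicial functor induces a strict pseudofunctor of
homotopy 2-categories (`hoPseudofunctor`), which is therefore an equivalence on hom-categories when
`F` is a weak equivalence; surjectivity on objects up to equivalence is part of the hypothesis
(`CosmosFunctor.IsWeakEquivalence.isBiequivalence`).

*Liftings.* A 2-cell is an absolute right (or left) lifting exactly when pasting with it is
bijective on 2-cells at all test 1-cells. Up to equivalence of the test object and isomorphism of
the test 1-cells, these may be taken in the image of a biequivalence, where the bijections
correspond to those in the source: `IsBiequivalence.isAbsRightLift_map_iff` and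
`IsBiequivalence.isAbsLeftLift_map_iff`. Limits and colimits are liftings through the constant
diagram functor, and it remains to compare along the isomorphisms `F 1 ≅ 1` and `F (A^J) ≅ (F A)^J`,
which are compatible with constant diagrams (`CosmosFunctor.map_constDiagram`).

*Adjunctions.* They are absolute left liftings of identities (`nonempty_adjunction_iff`), so they are
covered by the same result.

*Existence.* A 1-cell between objects in the image of `F` is isomorphic to the image of a 1-cell,
and all the notions are invariant under isomorphism of 1-cells.
-/

noncomputable section

namespace Cosmos

/-! ### Absolute liftings in a bicategory -/

/-- Two maps related by a commutative square with bijective sides are simultaneously bijective. -/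
theorem bijective_iff_of_equiv {α α' β β' : Type*} {φ : α → β} {φ' : α' → β'}
    (e₁ : α ≃ α') (e₂ : β ≃ β') (h : ∀ a, φ' (e₁ a) = e₂ (φ a)) :
    Function.Bijective φ ↔ Function.Bijective φ' := by
  have : φ' ∘ e₁ = e₂ ∘ φ := funext h
  rw [← e₁.bijective.of_comp_iff, this, e₂.bijective.of_comp_iff']

section Bicategory

open Bicategory

universe w' v' u' w'' v'' u''

variable {B : Type u'} [Bicategory.{w', v'} B] {a b c d : B}

/-- Pasting with a 2-cell `η : l ≫ f ⟶ g`: the map from 2-cells `k ⟶ h ≫ l` to 2-cells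
`k ≫ f ⟶ h ≫ g` whose bijectivity, for all `h` and `k`, says that `η` is an absolute right
lifting. -/
def rightLiftMap {f : b ⟶ a} {g : c ⟶ a} {l : c ⟶ b} (η : l ≫ f ⟶ g) {x : B} (h : x ⟶ c)
    (k : x ⟶ b) (ζ : k ⟶ h ≫ l) : k ≫ f ⟶ h ≫ g :=
  ζ ▷ f ≫ (α_ h l f).hom ≫ h ◁ η

/-- Pasting with a 2-cell `η : g ⟶ l ≫ f`: the map from 2-cells `h ≫ l ⟶ k` to 2-cells
`h ≫ g ⟶ k ≫ f` whose bijectivity, for all `h` and `k`, says that `η` is an absolute left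
lifting. -/
def leftLiftMap {f : b ⟶ a} {g : c ⟶ a} {l : c ⟶ b} (η : g ⟶ l ≫ f) {x : B} (h : x ⟶ c)
    (k : x ⟶ b) (ζ : h ≫ l ⟶ k) : h ≫ g ⟶ k ≫ f :=
  h ◁ η ≫ (α_ h l f).inv ≫ ζ ▷ f

/-- The 1-cell `l` underlies an absolute right lifting of `g` through `f`. The lifting 2-cell is not
part of the data, so that the notion is invariant under isomorphism of each of the three
1-cells. -/
def IsAbsRightLift (f : b ⟶ a) (g : c ⟶ a) (l : c ⟶ b) : Prop :=
  ∃ η : l ≫ f ⟶ g, ∀ (x : B) (h : x ⟶ c) (k : x ⟶ b), Function.Bijective (rightLiftMap η h k)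

/-- The 1-cell `l` underlies an absolute left lifting of `g` through `f`, for some 2-cell
`g ⟶ l ≫ f`. -/
def IsAbsLeftLift (f : b ⟶ a) (g : c ⟶ a) (l : c ⟶ b) : Prop :=
  ∃ η : g ⟶ l ≫ f, ∀ (x : B) (h : x ⟶ c) (k : x ⟶ b), Function.Bijective (leftLiftMap η h k)

theorem rightLiftMap_eq {f : b ⟶ a} {g : c ⟶ a} {l : c ⟶ b} (η : l ≫ f ⟶ g) {x : B} (h : x ⟶ c)
    (k : x ⟶ b) (ζ : k ⟶ h ≫ l) :
    rightLiftMap η h k ζ = ζ ▷ f ≫ ((RightLift.mk l η).whisker h).counit := by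
  rw [RightLift.whisker_counit]; rfl

theorem leftLiftMap_eq {f : b ⟶ a} {g : c ⟶ a} {l : c ⟶ b} (η : g ⟶ l ≫ f) {x : B} (h : x ⟶ c)
    (k : x ⟶ b) (ζ : h ≫ l ⟶ k) :
    leftLiftMap η h k ζ = ((LeftLift.mk l η).whisker h).unit ≫ ζ ▷ f := by
  rw [LeftLift.whisker_unit]; exact (Category.assoc _ _ _).symm

theorem nonempty_rightLift_isAbsKan_iff {f : b ⟶ a} {g : c ⟶ a} {l : c ⟶ b} (η : l ≫ f ⟶ g) :
    Nonempty (RightLift.IsAbsKan (RightLift.mk l η)) ↔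
      ∀ (x : B) (h : x ⟶ c) (k : x ⟶ b), Function.Bijective (rightLiftMap η h k) := by
  simp only [funext (rightLiftMap_eq η _ _)]
  constructor
  · rintro ⟨H⟩ x h k
    exact ⟨fun ζ ζ' e => (H h).hom_ext e,
      fun θ => ⟨(H h).desc (RightLift.mk k θ), (H h).fac (RightLift.mk k θ)⟩⟩
  · intro H
    refine ⟨fun {x} h => RightLift.IsKan.mk
      (fun s => RightLift.homMk ((H x h s.lift).2 s.counit).choose
        ((H x h s.lift).2 s.counit).choose_spec) fun s τ => ?_⟩
    exact CostructuredArrow.hom_ext _ _ ((H x h s.lift).1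
      ((RightLift.w τ).trans ((H x h s.lift).2 s.counit).choose_spec.symm))

theorem nonempty_leftLift_isAbsKan_iff {f : b ⟶ a} {g : c ⟶ a} {l : c ⟶ b} (η : g ⟶ l ≫ f) :
    Nonempty (LeftLift.IsAbsKan (LeftLift.mk l η)) ↔
      ∀ (x : B) (h : x ⟶ c) (k : x ⟶ b), Function.Bijective (leftLiftMap η h k) := by
  simp only [funext (leftLiftMap_eq η _ _)]
  constructor
  · rintro ⟨H⟩ x h k
    exact ⟨fun ζ ζ' e => (H h).hom_ext e,
      fun θ => ⟨(H h).desc (LeftLift.mk k θ), (H h).fac (LeftLift.mk k θ)⟩⟩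
  · intro H
    refine ⟨fun {x} h => LeftLift.IsKan.mk
      (fun s => LeftLift.homMk ((H x h s.lift).2 s.unit).choose
        ((H x h s.lift).2 s.unit).choose_spec) fun s τ => ?_⟩
    exact StructuredArrow.hom_ext _ _ ((H x h s.lift).1
      ((LeftLift.w τ).trans ((H x h s.lift).2 s.unit).choose_spec.symm))

theorem rightLiftMap_bijective_congr {f : b ⟶ a} {g : c ⟶ a} {l : c ⟶ b} (η : l ≫ f ⟶ g) {x : B}
    {h h' : x ⟶ c} {k k' : x ⟶ b} (i : h ≅ h') (j : k ≅ k') :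
    Function.Bijective (rightLiftMap η h k) ↔ Function.Bijective (rightLiftMap η h' k') :=
  bijective_iff_of_equiv (Iso.homCongr j (whiskerRightIso i l))
    (Iso.homCongr (whiskerRightIso j f) (whiskerRightIso i g)) fun ζ => by
      simp [rightLiftMap, Bicategory.associator_naturality_left_assoc,
        ← Bicategory.whisker_exchange, -Bicategory.whiskerRight_comp]

theorem leftLiftMap_bijective_congr {f : b ⟶ a} {g : c ⟶ a} {l : c ⟶ b} (η : g ⟶ l ≫ f) {x : B}
    {h h' : x ⟶ c} {k k' : x ⟶ b} (i : h ≅ h') (j : k ≅ k') :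
    Function.Bijective (leftLiftMap η h k) ↔ Function.Bijective (leftLiftMap η h' k') :=
  bijective_iff_of_equiv (Iso.homCongr (whiskerRightIso i l) j)
    (Iso.homCongr (whiskerRightIso i g) (whiskerRightIso j f)) fun ζ => by
      simp [leftLiftMap, ← Bicategory.associator_inv_naturality_left_assoc,
        Bicategory.whisker_exchange_assoc, -Bicategory.whiskerRight_comp]

theorem isAbsRightLift_congr {f f' : b ⟶ a} {g g' : c ⟶ a} {l l' : c ⟶ b}
    (i : f ≅ f') (j : g ≅ g') (m : l ≅ l') (H : IsAbsRightLift f g l) : IsAbsRightLift f' g' l' := by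
  obtain ⟨η, H⟩ := H
  refine ⟨m.inv ▷ f' ≫ l ◁ i.inv ≫ η ≫ j.hom, fun x h k => ?_⟩
  refine (bijective_iff_of_equiv (Iso.homCongr (Iso.refl k) (whiskerLeftIso h m))
    (Iso.homCongr (whiskerLeftIso k i) (whiskerLeftIso h j)) fun ζ => ?_).1 (H x h k)
  simp [rightLiftMap, ← Bicategory.associator_naturality_right_assoc,
    Bicategory.whisker_exchange_assoc, -Bicategory.comp_whiskerLeft]

theorem isAbsLeftLift_congr {f f' : b ⟶ a} {g g' : c ⟶ a} {l l' : c ⟶ b}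
    (i : f ≅ f') (j : g ≅ g') (m : l ≅ l') (H : IsAbsLeftLift f g l) : IsAbsLeftLift f' g' l' := by
  obtain ⟨η, H⟩ := H
  refine ⟨j.inv ≫ η ≫ l ◁ i.hom ≫ m.hom ▷ f', fun x h k => ?_⟩
  refine (bijective_iff_of_equiv (Iso.homCongr (whiskerLeftIso h m) (Iso.refl k))
    (Iso.homCongr (whiskerLeftIso h j) (whiskerLeftIso k i)) fun ζ => ?_).1 (H x h k)
  simp [leftLiftMap]
  simp [Bicategory.associator_inv_naturality_right_assoc,
    Bicategory.whisker_exchange, -Bicategory.comp_whiskerLeft]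

/-! ### Liftings and equivalence 1-cells -/

theorem precomp_isEquivalence {t : a ⟶ b} {s : b ⟶ a} (η : 𝟙 a ≅ t ≫ s) (e : s ≫ t ≅ 𝟙 b) :
    (precomp c t).IsEquivalence :=
  Functor.IsEquivalence.mk' (precomp c s)
    (NatIso.ofComponents
      (fun k => (Bicategory.leftUnitor k).symm ≪≫ whiskerRightIso e.symm k ≪≫
        Bicategory.associator s t k) fun φ => by
          simp [precomp, Bicategory.leftUnitor_inv_naturality_assoc,
            Bicategory.whisker_exchange_assoc, -Bicategory.id_whiskerLeft])
    (NatIso.ofComponents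
      (fun k => (Bicategory.associator t s k).symm ≪≫ whiskerRightIso η.symm k ≪≫
        Bicategory.leftUnitor k) fun φ => by
          simp [precomp, ← Bicategory.leftUnitor_naturality,
            ← Bicategory.whisker_exchange_assoc, -Bicategory.id_whiskerLeft])

theorem postcomp_isEquivalence {t : a ⟶ b} {s : b ⟶ a} (η : 𝟙 a ≅ t ≫ s) (e : s ≫ t ≅ 𝟙 b) :
    (postcomp c t).IsEquivalence :=
  Functor.IsEquivalence.mk' (postcomp c s)
    (NatIso.ofComponents
      (fun k => (Bicategory.rightUnitor k).symm ≪≫ whiskerLeftIso k η ≪≫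
        (Bicategory.associator k t s).symm) fun φ => by
          simp [postcomp, Bicategory.rightUnitor_inv_naturality_assoc,
            ← Bicategory.whisker_exchange_assoc, -Bicategory.whiskerRight_id])
    (NatIso.ofComponents
      (fun k => Bicategory.associator k s t ≪≫ whiskerLeftIso k e ≪≫
        Bicategory.rightUnitor k) fun φ => by
          simp [postcomp, ← Bicategory.rightUnitor_naturality,
            Bicategory.whisker_exchange_assoc, -Bicategory.whiskerRight_id])

/-- Whiskering on the left by a 1-cell whose precomposition functor is an equivalence, as a
bijection on 2-cells. -/
def whiskerLeftEquiv (t : a ⟶ b) [(precomp c t).IsEquivalence] (k k' : b ⟶ c) :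
    (k ⟶ k') ≃ (t ≫ k ⟶ t ≫ k') :=
  (Functor.FullyFaithful.ofFullyFaithful (precomp c t)).homEquiv

theorem whiskerLeftEquiv_apply (t : a ⟶ b) [(precomp c t).IsEquivalence] {k k' : b ⟶ c}
    (φ : k ⟶ k') : whiskerLeftEquiv t k k' φ = t ◁ φ := rfl

/-- Whiskering on the right by a 1-cell whose postcomposition functor is an equivalence, as a
bijection on 2-cells. -/
def whiskerRightEquiv (t : a ⟶ b) [(postcomp c t).IsEquivalence] (k k' : c ⟶ a) :
    (k ⟶ k') ≃ (k ≫ t ⟶ k' ≫ t) :=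
  (Functor.FullyFaithful.ofFullyFaithful (postcomp c t)).homEquiv

theorem whiskerRightEquiv_apply (t : a ⟶ b) [(postcomp c t).IsEquivalence] {k k' : c ⟶ a}
    (φ : k ⟶ k') : whiskerRightEquiv t k k' φ = φ ▷ t := rfl

/-- The universal property of a right lifting at a test object `x` may be tested at any `y`
equivalent to `x`. -/
theorem rightLiftMap_bijective_precomp_iff {f : b ⟶ a} {g : c ⟶ a} {l : c ⟶ b} (η : l ≫ f ⟶ g)
    {x y : B} (t : y ⟶ x) [∀ z : B, (precomp z t).IsEquivalence] (h : x ⟶ c) (k : x ⟶ b) :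
    Function.Bijective (rightLiftMap η h k) ↔
      Function.Bijective (rightLiftMap η (t ≫ h) (t ≫ k)) :=
  bijective_iff_of_equiv
    ((whiskerLeftEquiv t k (h ≫ l)).trans (Iso.homCongr (Iso.refl _) (α_ t h l).symm))
    ((whiskerLeftEquiv t (k ≫ f) (h ≫ g)).trans (Iso.homCongr (α_ t k f).symm (α_ t h g).symm))
    fun ζ => by
      simp [rightLiftMap, whiskerLeftEquiv_apply]

/-- The universal property of a left lifting at a test object `x` may be tested at any `y`
equivalent to `x`. -/
theorem leftLiftMap_bijective_precomp_iff {f : b ⟶ a} {g : c ⟶ a} {l : c ⟶ b} (η : g ⟶ l ≫ f)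
    {x y : B} (t : y ⟶ x) [∀ z : B, (precomp z t).IsEquivalence] (h : x ⟶ c) (k : x ⟶ b) :
    Function.Bijective (leftLiftMap η h k) ↔
      Function.Bijective (leftLiftMap η (t ≫ h) (t ≫ k)) :=
  bijective_iff_of_equiv
    ((whiskerLeftEquiv t (h ≫ l) k).trans (Iso.homCongr (α_ t h l).symm (Iso.refl _)))
    ((whiskerLeftEquiv t (h ≫ g) (k ≫ f)).trans (Iso.homCongr (α_ t h g).symm (α_ t k f).symm))
    fun ζ => by
      simp [leftLiftMap, whiskerLeftEquiv_apply]

theorem isAbsRightLift_postcomp_iff {f : b ⟶ a} {g : c ⟶ a} {l : c ⟶ b} (t : a ⟶ d)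
    [∀ z : B, (postcomp z t).IsEquivalence] :
    IsAbsRightLift f g l ↔ IsAbsRightLift (f ≫ t) (g ≫ t) l := by
  have key (η : l ≫ f ⟶ g) (x : B) (h : x ⟶ c) (k : x ⟶ b) :
      Function.Bijective (rightLiftMap η h k) ↔
        Function.Bijective (rightLiftMap ((α_ l f t).inv ≫ η ▷ t : l ≫ f ≫ t ⟶ g ≫ t) h k) :=
    bijective_iff_of_equiv (Equiv.refl _)
      ((whiskerRightEquiv t (k ≫ f) (h ≫ g)).trans (Iso.homCongr (α_ k f t) (α_ h g t))) fun ζ => by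
        simp [rightLiftMap, whiskerRightEquiv_apply]
  constructor
  · rintro ⟨η, H⟩
    exact ⟨_, fun x h k => (key η x h k).1 (H x h k)⟩
  · rintro ⟨η, H⟩
    obtain ⟨θ, hθ⟩ := (whiskerRightEquiv t _ _).surjective ((α_ l f t).hom ≫ η)
    obtain rfl : (α_ l f t).inv ≫ θ ▷ t = η := by
      rw [← whiskerRightEquiv_apply, hθ, Iso.inv_hom_id_assoc]
    exact ⟨θ, fun x h k => (key θ x h k).2 (H x h k)⟩

theorem isAbsLeftLift_postcomp_iff {f : b ⟶ a} {g : c ⟶ a} {l : c ⟶ b} (t : a ⟶ d)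
    [∀ z : B, (postcomp z t).IsEquivalence] :
    IsAbsLeftLift f g l ↔ IsAbsLeftLift (f ≫ t) (g ≫ t) l := by
  have key (η : g ⟶ l ≫ f) (x : B) (h : x ⟶ c) (k : x ⟶ b) :
      Function.Bijective (leftLiftMap η h k) ↔
        Function.Bijective (leftLiftMap (η ▷ t ≫ (α_ l f t).hom : g ≫ t ⟶ l ≫ f ≫ t) h k) :=
    bijective_iff_of_equiv (Equiv.refl _)
      ((whiskerRightEquiv t (h ≫ g) (k ≫ f)).trans (Iso.homCongr (α_ h g t) (α_ k f t))) fun ζ => by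
        simp [leftLiftMap, whiskerRightEquiv_apply]
  constructor
  · rintro ⟨η, H⟩
    exact ⟨_, fun x h k => (key η x h k).1 (H x h k)⟩
  · rintro ⟨η, H⟩
    obtain ⟨θ, hθ⟩ := (whiskerRightEquiv t _ _).surjective (η ≫ (α_ l f t).inv)
    obtain rfl : θ ▷ t ≫ (α_ l f t).hom = η := by
      rw [← whiskerRightEquiv_apply, hθ, Category.assoc, Iso.inv_hom_id, Category.comp_id]
    exact ⟨θ, fun x h k => (key θ x h k).2 (H x h k)⟩

theorem IsAbsRightLift.precomp {f : b ⟶ a} {g : c ⟶ a} {l : c ⟶ b} (H : IsAbsRightLift f g l)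
    (t : d ⟶ c) : IsAbsRightLift f (t ≫ g) (t ≫ l) := by
  obtain ⟨η, H⟩ := H
  refine ⟨(α_ t l f).hom ≫ t ◁ η, fun x h k => ?_⟩
  refine (bijective_iff_of_equiv (Iso.homCongr (Iso.refl _) (α_ h t l))
    (Iso.homCongr (Iso.refl _) (α_ h t g)) fun ζ => ?_).1 (H x (h ≫ t) k)
  simp [rightLiftMap]

theorem IsAbsLeftLift.precomp {f : b ⟶ a} {g : c ⟶ a} {l : c ⟶ b} (H : IsAbsLeftLift f g l)
    (t : d ⟶ c) : IsAbsLeftLift f (t ≫ g) (t ≫ l) := by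
  obtain ⟨η, H⟩ := H
  refine ⟨t ◁ η ≫ (α_ t l f).inv, fun x h k => ?_⟩
  refine (bijective_iff_of_equiv (Iso.homCongr (α_ h t l) (Iso.refl _))
    (Iso.homCongr (α_ h t g) (Iso.refl _)) fun ζ => ?_).1 (H x (h ≫ t) k)
  simp [leftLiftMap]

/-- A 1-cell is left adjoint to `u` exactly when it is an absolute left lifting of the identity
through `u`. This reduces adjunctions to liftings. -/
theorem nonempty_adjunction_iff {f : a ⟶ b} {u : b ⟶ a} :
    Nonempty (Bicategory.Adjunction f u) ↔ IsAbsLeftLift u (𝟙 a) f := by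
  simp only [IsAbsLeftLift, ← nonempty_leftLift_isAbsKan_iff]
  exact ⟨fun ⟨adj⟩ => ⟨adj.unit, ⟨adj.isAbsoluteLeftKanLift⟩⟩,
    fun ⟨η, ⟨H⟩⟩ => ⟨LeftLift.IsAbsKan.adjunction (LeftLift.mk f η) H⟩⟩

/-! ### Liftings and adjunctions under a biequivalence -/

section Pseudofunctor

variable {C : Type u''} [Bicategory.{w'', v''} C] (F : Pseudofunctor B C)

/-- A pseudofunctor is a biequivalence if it is an equivalence on hom-categories and essentially
surjective on objects up to equivalence. -/
structure IsBiequivalence : Prop where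
  isEquivalence_mapFunctor (a b : B) : (F.mapFunctor a b).IsEquivalence
  exists_equivalence (y : C) : ∃ x : B, Nonempty (Bicategory.Equivalence (F.obj x) y)

variable {F}

theorem IsBiequivalence.exists_map_iso (hF : IsBiequivalence F) (g : F.obj a ⟶ F.obj b) :
    ∃ f : a ⟶ b, Nonempty (F.map f ≅ g) := by
  have := hF.isEquivalence_mapFunctor a b
  exact ⟨(F.mapFunctor a b).objPreimage g, ⟨(F.mapFunctor a b).objObjPreimageIso g⟩⟩

/-- The bijection on 2-cells given by a biequivalence. -/
def IsBiequivalence.map₂Equiv (hF : IsBiequivalence F) (f g : a ⟶ b) :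
    (f ⟶ g) ≃ (F.map f ⟶ F.map g) :=
  have := hF.isEquivalence_mapFunctor a b
  (Functor.FullyFaithful.ofFullyFaithful (F.mapFunctor a b)).homEquiv

theorem IsBiequivalence.map₂Equiv_apply (hF : IsBiequivalence F) {f g : a ⟶ b} (φ : f ⟶ g) :
    hF.map₂Equiv f g φ = F.map₂ φ := rfl

theorem IsBiequivalence.rightLiftMap_bijective_iff (hF : IsBiequivalence F) {f : b ⟶ a} {g : c ⟶ a}
    {l : c ⟶ b} (η : l ≫ f ⟶ g) {x : B} (h : x ⟶ c) (k : x ⟶ b) :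
    Function.Bijective (rightLiftMap η h k) ↔
      Function.Bijective
        (rightLiftMap ((F.mapComp l f).inv ≫ F.map₂ η) (F.map h) (F.map k)) :=
  bijective_iff_of_equiv
    ((hF.map₂Equiv _ _).trans (Iso.homCongr (Iso.refl _) (F.mapComp h l)))
    ((hF.map₂Equiv _ _).trans (Iso.homCongr (F.mapComp k f) (F.mapComp h g))) fun ζ => by
      simp [rightLiftMap, hF.map₂Equiv_apply]

theorem IsBiequivalence.leftLiftMap_bijective_iff (hF : IsBiequivalence F) {f : b ⟶ a} {g : c ⟶ a}
    {l : c ⟶ b} (η : g ⟶ l ≫ f) {x : B} (h : x ⟶ c) (k : x ⟶ b) :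
    Function.Bijective (leftLiftMap η h k) ↔
      Function.Bijective
        (leftLiftMap (F.map₂ η ≫ (F.mapComp l f).hom) (F.map h) (F.map k)) :=
  bijective_iff_of_equiv
    ((hF.map₂Equiv _ _).trans (Iso.homCongr (F.mapComp h l) (Iso.refl _)))
    ((hF.map₂Equiv _ _).trans (Iso.homCongr (F.mapComp h g) (F.mapComp k f))) fun ζ => by
      -- Compatibility of `F` with associators, in the form with inverse associators.
      have key : F.map h ◁ (F.mapComp l f).hom ≫ (α_ (F.map h) (F.map l) (F.map f)).inv ≫
          (F.mapComp h l).inv ▷ F.map f = (F.mapComp h (l ≫ f)).inv ≫ F.map₂ (α_ h l f).inv ≫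
            (F.mapComp (h ≫ l) f).hom := by
        rw [← cancel_mono (F.mapComp (h ≫ l) f).inv]
        simp [F.mapComp_assoc_left_inv]
      simp [leftLiftMap, hF.map₂Equiv_apply, reassoc_of% key]

theorem isEquivalence_precomp_hom {x y : B} (e : Bicategory.Equivalence x y) (z : B) :
    (precomp z e.hom).IsEquivalence :=
  precomp_isEquivalence e.unit e.counit

theorem IsBiequivalence.isAbsRightLift_map_iff (hF : IsBiequivalence F) {f : b ⟶ a} {g : c ⟶ a}
    {l : c ⟶ b} : IsAbsRightLift (F.map f) (F.map g) (F.map l) ↔ IsAbsRightLift f g l := by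
  constructor
  · rintro ⟨η, H⟩
    obtain ⟨θ, hθ⟩ := (hF.map₂Equiv _ _).surjective ((F.mapComp l f).hom ≫ η)
    obtain rfl : (F.mapComp l f).inv ≫ F.map₂ θ = η := by
      rw [← hF.map₂Equiv_apply, hθ, Iso.inv_hom_id_assoc]
    exact ⟨θ, fun x h k => (hF.rightLiftMap_bijective_iff θ h k).2 (H _ _ _)⟩
  · rintro ⟨η, H⟩
    refine ⟨(F.mapComp l f).inv ≫ F.map₂ η, fun y h k => ?_⟩
    -- Move the test object and the two test 1-cells into the image of `F`.
    obtain ⟨x, ⟨e⟩⟩ := hF.exists_equivalence y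
    have := isEquivalence_precomp_hom e
    obtain ⟨h', ⟨i⟩⟩ := hF.exists_map_iso (e.hom ≫ h)
    obtain ⟨k', ⟨j⟩⟩ := hF.exists_map_iso (e.hom ≫ k)
    rw [rightLiftMap_bijective_precomp_iff _ e.hom, ← rightLiftMap_bijective_congr _ i j,
      ← hF.rightLiftMap_bijective_iff]
    exact H x h' k'

theorem IsBiequivalence.isAbsLeftLift_map_iff (hF : IsBiequivalence F) {f : b ⟶ a} {g : c ⟶ a}
    {l : c ⟶ b} : IsAbsLeftLift (F.map f) (F.map g) (F.map l) ↔ IsAbsLeftLift f g l := by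
  constructor
  · rintro ⟨η, H⟩
    obtain ⟨θ, hθ⟩ := (hF.map₂Equiv _ _).surjective (η ≫ (F.mapComp l f).inv)
    obtain rfl : F.map₂ θ ≫ (F.mapComp l f).hom = η := by
      rw [← hF.map₂Equiv_apply, hθ, Category.assoc, Iso.inv_hom_id, Category.comp_id]
    exact ⟨θ, fun x h k => (hF.leftLiftMap_bijective_iff θ h k).2 (H _ _ _)⟩
  · rintro ⟨η, H⟩
    refine ⟨F.map₂ η ≫ (F.mapComp l f).hom, fun y h k => ?_⟩
    -- Move the test object and the two test 1-cells into the image of `F`.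
    obtain ⟨x, ⟨e⟩⟩ := hF.exists_equivalence y
    have := isEquivalence_precomp_hom e
    obtain ⟨h', ⟨i⟩⟩ := hF.exists_map_iso (e.hom ≫ h)
    obtain ⟨k', ⟨j⟩⟩ := hF.exists_map_iso (e.hom ≫ k)
    rw [leftLiftMap_bijective_precomp_iff _ e.hom, ← leftLiftMap_bijective_congr _ i j,
      ← hF.leftLiftMap_bijective_iff]
    exact H x h' k'

theorem nonempty_adjunction_congr {f f' : a ⟶ b} {u u' : b ⟶ a} (i : f ≅ f') (j : u ≅ u')
    (H : Nonempty (Bicategory.Adjunction f u)) : Nonempty (Bicategory.Adjunction f' u') := by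
  rw [nonempty_adjunction_iff] at H ⊢
  exact isAbsLeftLift_congr j (Iso.refl _) i H

theorem IsBiequivalence.nonempty_adjunction_map_iff (hF : IsBiequivalence F) {f : a ⟶ b}
    {u : b ⟶ a} : Nonempty (Bicategory.Adjunction (F.map f) (F.map u)) ↔
      Nonempty (Bicategory.Adjunction f u) := by
  rw [nonempty_adjunction_iff, nonempty_adjunction_iff, ← hF.isAbsLeftLift_map_iff]
  exact ⟨isAbsLeftLift_congr (Iso.refl _) (F.mapId a).symm (Iso.refl _),
    isAbsLeftLift_congr (Iso.refl _) (F.mapId a) (Iso.refl _)⟩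

end Pseudofunctor

end Bicategory

/-! ### Equivalences of quasi-categories on homotopy categories -/

/-- An invertible edge of a simplicial set gives an isomorphism in its homotopy category. -/
def isoOfInvStruct {X : SSet.{v}} {x y : X _⦋0⦌} {e : SSet.Edge x y} (h : e.InvStruct) :
    (SSet.hoFunctor.obj.equiv X).symm x ≅ (SSet.hoFunctor.obj.equiv X).symm y where
  hom := SSet.Truncated.HomotopyCategory.homMk e.toTruncated
  inv := SSet.Truncated.HomotopyCategory.homMk h.inv.toTruncated
  hom_inv_id := (SSet.Truncated.HomotopyCategory.homMk_comp_homMk h.homInvId.toTruncated).trans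
    (SSet.Truncated.HomotopyCategory.homMk_id _)
  inv_hom_id := (SSet.Truncated.HomotopyCategory.homMk_comp_homMk h.invHomId.toTruncated).trans
    (SSet.Truncated.HomotopyCategory.homMk_id _)

/-- Constant maps at the two ends of an invertible edge induce isomorphic functors: each of these
functors factors through the terminal category. -/
theorem nonempty_iso_ho_const {X Y : SSet.{v}} {x y : Y _⦋0⦌} {e : SSet.Edge x y}
    (h : e.InvStruct) :
    Nonempty ((SSet.hoFunctor.{v}.map (SSet.const x : X ⟶ Y)).toFunctor ≅
      (SSet.hoFunctor.{v}.map (SSet.const y : X ⟶ Y)).toFunctor) := by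
  have key (z : Y _⦋0⦌) : (SSet.hoFunctor.{v}.map (SSet.const z : X ⟶ Y)).toFunctor =
      (SSet.hoFunctor.map (toUnit X) ≫ Functor.OplaxMonoidal.η SSet.hoFunctor).toFunctor ⋙
        (Functor.const _).obj ((SSet.hoFunctor.obj.equiv Y).symm z) := by
    have h₁ := SSet.hoFunctor.unitHomEquiv_eq Y (SSet.const z)
    have h₂ : SSet.unitHomEquiv Y (SSet.const z) = z := by
      simp [SSet.unitHomEquiv, SSet.const]
    have h₃ : SSet.hoFunctor.unitHomEquiv Y (SSet.const z) =
      (Functor.const _).obj ((SSet.hoFunctor.obj.equiv Y).symm z) := by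
      conv_rhs => rw [← h₂]
      rfl
    refine Eq.trans ?_ (congrArg (fun G => (SSet.hoFunctor.map (toUnit X) ≫
      Functor.OplaxMonoidal.η SSet.hoFunctor).toFunctor ⋙ G) (h₁.symm.trans h₃))
    have h₄ : SSet.hoFunctor.map (SSet.const z : X ⟶ Y) =
        (SSet.hoFunctor.map (toUnit X) ≫ Functor.OplaxMonoidal.η SSet.hoFunctor) ≫
          Functor.LaxMonoidal.ε SSet.hoFunctor ≫ SSet.hoFunctor.map (SSet.const z) := by
      rw [Category.assoc, Functor.Monoidal.η_ε_assoc, ← Functor.map_comp]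
      rfl
    rw [h₄]
    rfl
  rw [key, key]
  exact ⟨Functor.isoWhiskerLeft _ ((Functor.const _).mapIso (isoOfInvStruct h))⟩

/-- Isomorphic functors `p` and `q` have isomorphic graphs `(𝟙, p)` and `(𝟙, q)`. -/
def isoLiftId {C D : Cat.{v, v}} {p q : C ⟶ D} (i : p.toFunctor ≅ q.toFunctor) :
    (lift (𝟙 C) p).toFunctor ≅ (lift (𝟙 C) q).toFunctor :=
  show (𝟭 C).prod' p.toFunctor ≅ (𝟭 C).prod' q.toFunctor from
    NatIso.ofComponents (fun x => Iso.prod (Iso.refl _) (i.app x)) fun φ => by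
      ext <;> simp

/-- Homotopic maps induce isomorphic functors on homotopy categories, since `SSet.hoFunctor`
preserves the product with the interval. -/
theorem IsIsoHomotopy.nonempty_iso {X Y : SSet.{v}} {f g : X ⟶ Y} {H : X ⊗ SSet.coherentIso ⟶ Y}
    (h : IsIsoHomotopy f g H) :
    Nonempty ((SSet.hoFunctor.{v}.map f).toFunctor ≅ (SSet.hoFunctor.{v}.map g).toFunctor) := by
  have key (p : X ⟶ SSet.coherentIso) : SSet.hoFunctor.{v}.map (lift (𝟙 X) p ≫ H) =
      lift (𝟙 (SSet.hoFunctor.{v}.obj X)) (SSet.hoFunctor.{v}.map p) ≫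
        Functor.LaxMonoidal.μ SSet.hoFunctor _ _ ≫ SSet.hoFunctor.map H := by
    rw [Functor.map_comp, ← Functor.Monoidal.lift_μ, CategoryTheory.Functor.map_id, Category.assoc]
  rw [← h.source, ← h.target, key, key]
  obtain ⟨i⟩ := nonempty_iso_ho_const (X := X) SSet.coherentIso.invStructHom
  exact ⟨Functor.isoWhiskerRight (isoLiftId i) _⟩

theorem IsQCatEquivalence.isEquivalence_ho {X Y : SSet.{v}} {f : X ⟶ Y} (h : IsQCatEquivalence f) :
    (SSet.hoFunctor.{v}.map f).toFunctor.IsEquivalence := by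
  obtain ⟨g, ⟨H, hH⟩, ⟨H', hH'⟩⟩ := h
  obtain ⟨i⟩ := hH.nonempty_iso
  obtain ⟨j⟩ := hH'.nonempty_iso
  refine Functor.IsEquivalence.mk' (SSet.hoFunctor.{v}.map g).toFunctor
    (eqToIso ?_ ≪≫ i ≪≫ eqToIso ?_)
    (eqToIso ?_ ≪≫ j ≪≫ eqToIso ?_)
  all_goals simp; try rfl

/-! ### Enriched functors over `Cat` as strict pseudofunctors -/

section CatEnriched

universe w w' v' u' v'' u''

open CatEnrichedOrdinary Bicategory

/-- A 2-functor between categories enriched over `Cat`: a `Cat`-enriched functor, together with an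
action on the morphisms of the given underlying categories that corresponds to the enriched one
under `eHomEquiv`. -/
structure TwoFunctor (C : Type u') [Category.{v'} C] [EnrichedOrdinaryCategory Cat.{w, w'} C]
    (D : Type u'') [Category.{v''} D] [EnrichedOrdinaryCategory Cat.{w, w'} D] extends
    EnrichedFunctor Cat.{w, w'} (CatEnrichedOrdinary C) (CatEnrichedOrdinary D) where
  /-- The action on 1-cells. -/
  mapHom {X Y : CatEnrichedOrdinary C} : (X ⟶ Y) → (obj X ⟶ obj Y)
  eHomEquiv_mapHom {X Y : CatEnrichedOrdinary C} (f : X ⟶ Y) :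
    eHomEquiv Cat (mapHom f) = eHomEquiv Cat f ≫ map X Y

namespace TwoFunctor

variable {C : Type u'} [Category.{v'} C] [EnrichedOrdinaryCategory Cat.{w, w'} C]
  {D : Type u''} [Category.{v''} D] [EnrichedOrdinaryCategory Cat.{w, w'} D]
  (G : TwoFunctor C D)

/-- The action on hom-categories: `G.map X Y`, typed so that its source and target carry the
hom-category instances of `CatEnriched`. -/
def homFunctor (X Y : CatEnrichedOrdinary C) :
    (X.toBase ⟶ Y.toBase) ⥤ ((G.obj X).toBase ⟶ (G.obj Y).toBase) :=
  (G.map X Y).toFunctor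

theorem homEquiv_mapHom {X Y : CatEnrichedOrdinary C} (f : X ⟶ Y) :
    homEquiv (G.mapHom f) = (G.homFunctor X Y).obj (homEquiv f) := by
  unfold CatEnrichedOrdinary.homEquiv
  simp only [Equiv.trans_apply]
  rw [G.eHomEquiv_mapHom]
  rfl

theorem mapHom_id (X : CatEnrichedOrdinary C) : G.mapHom (𝟙 X) = 𝟙 (G.obj X) :=
  (eHomEquiv Cat).injective (by rw [G.eHomEquiv_mapHom, eHomEquiv_id, eHomEquiv_id, G.map_id])

theorem mapHom_comp {X Y Z : CatEnrichedOrdinary C} (f : X ⟶ Y) (g : Y ⟶ Z) :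
    G.mapHom (f ≫ g) = G.mapHom f ≫ G.mapHom g :=
  (eHomEquiv Cat).injective (by
    rw [G.eHomEquiv_mapHom, eHomEquiv_comp, eHomEquiv_comp, G.eHomEquiv_mapHom, G.eHomEquiv_mapHom,
      Category.assoc, Category.assoc, G.map_comp, ← tensorHom_comp_tensorHom, Category.assoc])

/-- The action on 2-cells. The action on hom-categories agrees with `G.mapHom` only up to the
equality `homEquiv_mapHom`, hence the conjugation by `eqToHom`. -/
def mapHom₂ {X Y : CatEnrichedOrdinary C} {f g : X ⟶ Y} (α : f ⟶ g) :
    G.mapHom f ⟶ G.mapHom g :=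
  Hom.mk (eqToHom (G.homEquiv_mapHom f) ≫ (G.homFunctor X Y).map (Hom.base α) ≫
    eqToHom (G.homEquiv_mapHom g).symm)

theorem mapHom₂_id {X Y : CatEnrichedOrdinary C} (f : X ⟶ Y) :
    G.mapHom₂ (𝟙 f) = 𝟙 (G.mapHom f) := by
  ext
  simp [mapHom₂]

theorem mapHom₂_comp {X Y : CatEnrichedOrdinary C} {f g h : X ⟶ Y} (α : f ⟶ g) (β : g ⟶ h) :
    G.mapHom₂ (α ≫ β) = G.mapHom₂ α ≫ G.mapHom₂ β := by
  ext
  simp [mapHom₂]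

theorem base_mapHom₂_heq {X Y : CatEnrichedOrdinary C} {f g : X ⟶ Y} (α : f ⟶ g) :
    HEq (Hom.base (G.mapHom₂ α)) ((G.homFunctor X Y).map (Hom.base α)) := by
  simp [mapHom₂]

theorem base_hComp_heq {X Y Z : CatEnrichedOrdinary C} {f f' : X ⟶ Y} {g g' : Y ⟶ Z}
    (α : f ⟶ f') (β : g ⟶ g') :
    HEq (Hom.base (hComp α β)) (CatEnriched.hComp (Hom.base α) (Hom.base β)) := by
  simp [hComp]

theorem catHComp_heq {X Y Z : CatEnriched C} {f f' k k' : X ⟶ Y} {g g' l l' : Y ⟶ Z}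
    {α : f ⟶ f'} {α' : k ⟶ k'} {β : g ⟶ g'} {β' : l ⟶ l'} (h₁ : f = k) (h₂ : f' = k') (h₃ : g = l)
    (h₄ : g' = l') (h₅ : HEq α α') (h₆ : HEq β β') :
    HEq (CatEnriched.hComp α β) (CatEnriched.hComp α' β') := by
  subst h₁ h₂ h₃ h₄
  rw [eq_of_heq h₅, eq_of_heq h₆]

theorem map_catHComp_heq {X Y Z : CatEnrichedOrdinary C} {f f' : X.toBase ⟶ Y.toBase}
    {g g' : Y.toBase ⟶ Z.toBase} (α : f ⟶ f') (β : g ⟶ g') :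
    HEq ((G.homFunctor X Z).map (CatEnriched.hComp α β))
      (CatEnriched.hComp ((G.homFunctor X Y).map α) ((G.homFunctor Y Z).map β)) :=
  congr_arg_heq (·.toFunctor.map (X := (_, _)) (Y := (_, _)) (α, β)) (G.map_comp X Y Z)

theorem mapHom₂_hComp {X Y Z : CatEnrichedOrdinary C} {f f' : X ⟶ Y} {g g' : Y ⟶ Z}
    (α : f ⟶ f') (β : g ⟶ g') :
    G.mapHom₂ (hComp α β) = eqToHom (G.mapHom_comp f g) ≫ hComp (G.mapHom₂ α) (G.mapHom₂ β) ≫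
      eqToHom (G.mapHom_comp f' g').symm := by
  ext
  simp only [Hom.base_comp, Hom.base_eqToHom, ← heq_eq_eq, heq_eqToHom_comp_iff,
    heq_comp_eqToHom_iff]
  refine (G.base_mapHom₂_heq _).trans (HEq.trans ?_ (base_hComp_heq _ _).symm)
  refine HEq.trans ?_ ((G.map_catHComp_heq (Hom.base α) (Hom.base β)).trans
    (catHComp_heq (G.homEquiv_mapHom _).symm (G.homEquiv_mapHom _).symm (G.homEquiv_mapHom _).symm
      (G.homEquiv_mapHom _).symm (G.base_mapHom₂_heq _).symm (G.base_mapHom₂_heq _).symm))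
  simp [hComp, eqToHom_map]

/-- A 2-functor, as a strict pseudofunctor of bicategories. -/
def pseudofunctor : StrictPseudofunctor (CatEnrichedOrdinary C) (CatEnrichedOrdinary D) :=
  StrictPseudofunctor.mk''
    { obj := G.obj
      map := G.mapHom
      map₂ := G.mapHom₂
      map₂_id := G.mapHom₂_id
      map₂_comp := G.mapHom₂_comp
      map_id := G.mapHom_id
      map_comp := G.mapHom_comp
      map₂_whisker_left := fun f _ _ η => by
        refine (G.mapHom₂_hComp (𝟙 f) η).trans ?_
        rw [G.mapHom₂_id]
        rfl
      map₂_whisker_right := fun η f => by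
        refine (G.mapHom₂_hComp η (𝟙 f)).trans ?_
        rw [G.mapHom₂_id]
        rfl }

theorem mapHom₂_bijective {X Y : CatEnrichedOrdinary C} [(G.homFunctor X Y).IsEquivalence]
    (f g : X ⟶ Y) : Function.Bijective (G.mapHom₂ (f := f) (g := g)) := by
  refine ⟨fun α β h => ?_, fun β => ?_⟩
  · ext
    exact (G.homFunctor X Y).map_injective
      ((cancel_mono _).1 ((cancel_epi _).1 (congrArg Hom.base h)))
  · obtain ⟨α, hα⟩ := (G.homFunctor X Y).map_surjective
      (eqToHom (G.homEquiv_mapHom f).symm ≫ Hom.base β ≫ eqToHom (G.homEquiv_mapHom g))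
    refine ⟨Hom.mk α, ?_⟩
    ext
    simp [mapHom₂, hα]

/-- An isomorphism in the enriched hom-category, as an invertible 2-cell. -/
def isoMk {X Y : CatEnrichedOrdinary C} {f g : X ⟶ Y} (i : homEquiv f ≅ homEquiv g) : f ≅ g where
  hom := Hom.mk i.hom
  inv := Hom.mk i.inv
  hom_inv_id := by ext; simp
  inv_hom_id := by ext; simp

theorem exists_mapHom_iso {X Y : CatEnrichedOrdinary C} [(G.homFunctor X Y).IsEquivalence]
    (g : G.obj X ⟶ G.obj Y) : ∃ f : X ⟶ Y, Nonempty (G.mapHom f ≅ g) := by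
  obtain ⟨x, ⟨i⟩⟩ := Functor.EssSurj.mem_essImage (F := G.homFunctor X Y) (homEquiv g)
  obtain ⟨f, rfl⟩ := homEquiv.surjective x
  exact ⟨f, ⟨isoMk (eqToIso (G.homEquiv_mapHom f) ≪≫ i)⟩⟩

theorem isEquivalence_mapFunctor (X Y : CatEnrichedOrdinary C)
    [(G.homFunctor X Y).IsEquivalence] :
    (G.pseudofunctor.toPseudofunctor.mapFunctor X Y).IsEquivalence where
  faithful := ⟨fun {f g} _ _ h => (G.mapHom₂_bijective f g).1 h⟩
  full := ⟨fun {f g} β => (G.mapHom₂_bijective f g).2 β⟩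
  essSurj := ⟨fun g => G.exists_mapHom_iso g⟩

end TwoFunctor

end CatEnriched

/-! ### The pseudofunctor of homotopy 2-categories -/

section Simplicial

theorem hoMap_comp {K : Type u} [Category.{v} K] {A B C : K} (f : A ⟶ B) (g : B ⟶ C) :
    hoMap (f ≫ g) = hoMap f ≫ hoMap g := rfl

variable {K : Type u₁} [Category.{v} K] [SimplicialCategory K]
  {L : Type u₂} [Category.{v} L] [SimplicialCategory L]

theorem eHomEquiv_underlying_map (F : EnrichedFunctor SSet.{v} K L) {A B : K} (f : A ⟶ B) :
    eHomEquiv SSet ((underlying F).map f) = eHomEquiv SSet f ≫ F.map A B :=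
  (eHomEquiv SSet).apply_symm_apply _

theorem eHomEquiv_hoMap {A B : K} (f : A ⟶ B) :
    eHomEquiv Cat.{v, v} (hoMap f) =
      Functor.LaxMonoidal.ε SSet.hoFunctor.{v} ≫ SSet.hoFunctor.map (eHomEquiv SSet f) :=
  congrArg (Functor.toCatHom) <| SSet.hoFunctor.unitHomEquiv_eq _ _

theorem ho_map_id (F : EnrichedFunctor SSet.{v} K L) (A : K) :
    (Functor.LaxMonoidal.ε SSet.hoFunctor.{v} ≫ SSet.hoFunctor.map (eId SSet A)) ≫
        SSet.hoFunctor.map (F.map A A) =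
      Functor.LaxMonoidal.ε SSet.hoFunctor.{v} ≫ SSet.hoFunctor.map (eId SSet (F.obj A)) := by
  rw [Category.assoc, ← Functor.map_comp, F.map_id]

theorem ho_map_comp (F : EnrichedFunctor SSet.{v} K L) (A B C : K) :
    (Functor.LaxMonoidal.μ SSet.hoFunctor.{v} _ _ ≫ SSet.hoFunctor.map (eComp SSet A B C)) ≫
        SSet.hoFunctor.map (F.map A C) =
      (SSet.hoFunctor.map (F.map A B) ⊗ₘ SSet.hoFunctor.map (F.map B C)) ≫
        Functor.LaxMonoidal.μ SSet.hoFunctor.{v} _ _ ≫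
          SSet.hoFunctor.map (eComp SSet (F.obj A) (F.obj B) (F.obj C)) := by
  rw [Category.assoc, ← Functor.map_comp, F.map_comp, Functor.map_comp,
    Functor.LaxMonoidal.μ_natural_assoc]

theorem eHomEquiv_hoMap_underlying (F : EnrichedFunctor SSet.{v} K L) {A B : K} (f : A ⟶ B) :
    eHomEquiv Cat.{v, v} (hoMap ((underlying F).map f)) =
      eHomEquiv Cat.{v, v} (hoMap f) ≫ SSet.hoFunctor.map (F.map A B) := by
  refine (eHomEquiv_hoMap _).trans (Eq.trans ?_
    (congrArg (· ≫ SSet.hoFunctor.map (F.map A B)) (eHomEquiv_hoMap f)).symm)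
  exact (congrArg (fun t => _ ≫ SSet.hoFunctor.map t) (eHomEquiv_underlying_map F f)).trans
    ((congrArg (_ ≫ ·) (Functor.map_comp _ _ _)).trans (Category.assoc _ _ _).symm)

/-- The 2-functor of homotopy 2-categories induced by a simplicial functor. -/
def hoTwoFunctor (F : EnrichedFunctor SSet.{v} K L) :
    TwoFunctor (TransportEnrichment SSet.hoFunctor.{v} K)
      (TransportEnrichment SSet.hoFunctor.{v} L) where
  obj := F.obj
  map A B := SSet.hoFunctor.map (F.map A B)
  map_id := ho_map_id F
  map_comp := ho_map_comp F
  mapHom f := (underlying F).map f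
  eHomEquiv_mapHom := eHomEquiv_hoMap_underlying F

/-- The pseudofunctor of homotopy 2-categories induced by a simplicial functor. -/
def hoPseudofunctor (F : EnrichedFunctor SSet.{v} K L) :
    Pseudofunctor (HomotopyTwoCategory.{v} K) (HomotopyTwoCategory.{v} L) :=
  (hoTwoFunctor F).pseudofunctor.toPseudofunctor

/-- A weak equivalence of `∞`-cosmoi induces a biequivalence of homotopy 2-categories. -/
theorem CosmosFunctor.IsWeakEquivalence.isBiequivalence [InfinityCosmos K] [InfinityCosmos L]
    {F : CosmosFunctor K L} (hF : F.IsWeakEquivalence) :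
    IsBiequivalence (hoPseudofunctor F.toEnrichedFunctor) where
  isEquivalence_mapFunctor A B :=
    haveI : ((hoTwoFunctor F.toEnrichedFunctor).homFunctor A B).IsEquivalence :=
      (hF.local_equivalence A B).isEquivalence_ho
    (hoTwoFunctor F.toEnrichedFunctor).isEquivalence_mapFunctor A B
  exists_equivalence := hF.surjective

instance isEquivalence_postcomp_hoMap {A B : K} (f : A ⟶ B) [IsIso f]
    (Z : HomotopyTwoCategory.{v} K) :
    (Bicategory.postcomp Z (hoMap f)).IsEquivalence :=
  postcomp_isEquivalence (s := hoMap (inv f)) (eqToIso (congrArg hoMap (IsIso.hom_inv_id f).symm))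
    (eqToIso (congrArg hoMap (IsIso.inv_hom_id f)))

theorem isAbsRightLift_precomp_iff {A B C D : K} {f : B ⟶ A} {g : C ⟶ A} {l : C ⟶ B} (t : D ⟶ C)
    [IsIso t] : IsAbsRightLift (hoMap f) (hoMap (t ≫ g)) (hoMap (t ≫ l)) ↔
      IsAbsRightLift (hoMap f) (hoMap g) (hoMap l) := by
  refine ⟨fun H => ?_, fun H => H.precomp (hoMap t)⟩
  have := H.precomp (hoMap (inv t))
  rwa [← hoMap_comp, ← hoMap_comp, IsIso.inv_hom_id_assoc, IsIso.inv_hom_id_assoc] at this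

theorem isAbsLeftLift_precomp_iff {A B C D : K} {f : B ⟶ A} {g : C ⟶ A} {l : C ⟶ B} (t : D ⟶ C)
    [IsIso t] : IsAbsLeftLift (hoMap f) (hoMap (t ≫ g)) (hoMap (t ≫ l)) ↔
      IsAbsLeftLift (hoMap f) (hoMap g) (hoMap l) := by
  refine ⟨fun H => ?_, fun H => H.precomp (hoMap t)⟩
  have := H.precomp (hoMap (inv t))
  rwa [← hoMap_comp, ← hoMap_comp, IsIso.inv_hom_id_assoc, IsIso.inv_hom_id_assoc] at this

end Simplicial

/-! ### Cotensors and constant diagrams -/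

section Cotensor

variable {K : Type u₁} [Category.{v} K] [SimplicialCategory K]

/-- Under the comparison `Fun(X, P) ⟶ Fun(X, A)^U`, a functor `g : X ⟶ P` corresponds to the
restriction of the cone along `g`. -/
theorem eHomEquiv_comp_curry_coneAction {U : SSet.{v}} {A P X : K} (cone : U ⟶ P ⟶[SSet] A)
    (g : X ⟶ P) : eHomEquiv SSet g ≫ MonoidalClosed.curry (coneAction cone X) =
      MonoidalClosed.curry ((ρ_ U).hom ≫ cone ≫ eHomWhiskerRight SSet g A) := by
  rw [← MonoidalClosed.curry_natural_left]
  -- the two transposes agree definitionally: both act on simplices by the same composite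
  congr 1

namespace IsCotensor

variable {U : SSet.{v}} {A P X : K} {cone : U ⟶ P ⟶[SSet] A}

theorem cone_comp_lift (h : IsCotensor cone) (x : U ⟶ X ⟶[SSet] A) :
    cone ≫ eHomWhiskerRight SSet (h.lift x) A = x := by
  have := h X
  have := eHomEquiv_comp_curry_coneAction cone (h.lift x)
  rw [IsCotensor.lift, Equiv.apply_symm_apply, Category.assoc, IsIso.inv_hom_id,
    Category.comp_id] at this
  exact ((cancel_epi _).1 (MonoidalClosed.curry_injective this)).symm

theorem hom_ext (h : IsCotensor cone) {g g' : X ⟶ P}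
    (e : cone ≫ eHomWhiskerRight SSet g A = cone ≫ eHomWhiskerRight SSet g' A) : g = g' := by
  have := h X
  apply (eHomEquiv SSet).injective
  rw [← cancel_mono (MonoidalClosed.curry (coneAction cone X)), eHomEquiv_comp_curry_coneAction,
    eHomEquiv_comp_curry_coneAction, e]

theorem isIso_lift (h : IsCotensor cone) {Q : K} {cone' : U ⟶ Q ⟶[SSet] A}
    (h' : IsCotensor cone') :
    IsIso (h.lift cone') :=
  ⟨h'.lift cone, h'.hom_ext (by simp [reassoc_of% h'.cone_comp_lift, h.cone_comp_lift]),
    h.hom_ext (by simp [reassoc_of% h.cone_comp_lift, h'.cone_comp_lift])⟩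

end IsCotensor

theorem cotensorCone_comp_constDiagram [HasCotensors K] (A : K) (J : SSet.{v}) :
    cotensorCone A J ≫ eHomWhiskerRight SSet (constDiagram A J) A = toUnit J ≫ eId SSet A :=
  IsCotensor.cone_comp_lift _ _

variable {L : Type u₂} [Category.{v} L] [SimplicialCategory L]

/-- An enriched functor commutes with precomposition by a morphism of the underlying category. -/
theorem map_comp_eHomWhiskerRight (F : EnrichedFunctor SSet.{v} K L) {A B : K} (g : A ⟶ B) (C : K) :
    F.map B C ≫ eHomWhiskerRight SSet (X := F.obj A) (X' := F.obj B) ((underlying F).map g)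
        (F.obj C) =
      eHomWhiskerRight SSet g C ≫ F.map A C := by
  have h : eHomEquiv SSet (X := F.obj A) (Y := F.obj B) ((underlying F).map g) =
      eHomEquiv SSet g ≫ F.map A B :=
    eHomEquiv_underlying_map F g
  dsimp only [eHomWhiskerRight]
  rw [h, Category.assoc, Category.assoc, F.map_comp,
    leftUnitor_inv_naturality_assoc]
  -- what remains is an equality of whiskered tensor products, true by unfolding on simplices
  congr 1

variable [InfinityCosmos K] [InfinityCosmos L]

namespace CosmosFunctor

variable (F : CosmosFunctor K L)

instance isIso_cotensorComparison (A : K) (J : SSet.{v}) : IsIso (F.cotensorComparison A J) :=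
  IsCotensor.isIso_lift _ (F.preservesCotensor _ (isCotensor_cotensorCone A J))

/-- The comparison `F (A^J) ≅ (F A)^J` carries the image of the constant diagram functor to the
constant diagram functor. -/
theorem map_constDiagram (A : K) (J : SSet.{v}) :
    F.functor.map (constDiagram A J) ≫ F.cotensorComparison A J =
      constDiagram (F.functor.obj A) J := by
  apply (isCotensor_cotensorCone (F.functor.obj A) J).hom_ext
  rw [eHomWhiskerRight_comp, cotensorCone_comp_constDiagram]
  have h₁ : cotensorCone (F.functor.obj A) J ≫ eHomWhiskerRight SSet (F.cotensorComparison A J) _ =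
      cotensorCone A J ≫ F.map (cotensor A J) A := IsCotensor.cone_comp_lift _ _
  rw [reassoc_of% h₁]
  refine (congrArg (cotensorCone A J ≫ ·)
    (map_comp_eHomWhiskerRight F.toEnrichedFunctor (constDiagram A J) A)).trans ?_
  rw [← Category.assoc, cotensorCone_comp_constDiagram, Category.assoc, F.map_id]
  rfl

end CosmosFunctor

end Cotensor

/-! ### Limits, colimits and adjunctions under a weak equivalence -/

section

variable {K : Type u₁} [Category.{v} K] [SimplicialCategory K] [InfinityCosmos K]
  {L : Type u₂} [Category.{v} L] [SimplicialCategory L] [InfinityCosmos L]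

theorem isLimitElement_iff {A : K} {J : SSet.{v}} {d : ⊤_ K ⟶ cotensor A J} {l : ⊤_ K ⟶ A} :
    IsLimitElement d l ↔ IsAbsRightLift (hoMap (constDiagram A J)) (hoMap d) (hoMap l) := by
  simp only [IsLimitElement, IsAbsRightLift, nonempty_rightLift_isAbsKan_iff]

theorem isColimitElement_iff {A : K} {J : SSet.{v}} {d : ⊤_ K ⟶ cotensor A J} {l : ⊤_ K ⟶ A} :
    IsColimitElement d l ↔ IsAbsLeftLift (hoMap (constDiagram A J)) (hoMap d) (hoMap l) := by
  simp only [IsColimitElement, IsAbsLeftLift, nonempty_leftLift_isAbsKan_iff]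

namespace CosmosFunctor

variable {F : CosmosFunctor K L}

theorem exists_map_iso (hF : F.IsWeakEquivalence) {A B : K}
    (g : F.functor.obj A ⟶ F.functor.obj B) :
    ∃ f : A ⟶ B, Nonempty (hoMap (F.functor.map f) ≅ hoMap g) :=
  hF.isBiequivalence.exists_map_iso (a := ho.{v} A) (b := ho.{v} B) (hoMap g)

theorem isLimitElement_map_iff (hF : F.IsWeakEquivalence) {A : K} {J : SSet.{v}}
    {d : ⊤_ K ⟶ cotensor A J} {l : ⊤_ K ⟶ A} :
    IsLimitElement (F.mapDiagram d) (F.mapElement l) ↔ IsLimitElement d l := by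
  rw [isLimitElement_iff, isLimitElement_iff, mapDiagram, mapElement, mapElement,
    ← map_constDiagram, hoMap_comp, hoMap_comp (_ ≫ _) (F.cotensorComparison A J),
    ← isAbsRightLift_postcomp_iff, isAbsRightLift_precomp_iff]
  -- the comparisons `F (A^J) ≅ (F A)^J` and `1 ≅ F 1` have been cancelled
  exact hF.isBiequivalence.isAbsRightLift_map_iff (f := hoMap (constDiagram A J)) (g := hoMap d)
    (l := hoMap l)

theorem isColimitElement_map_iff (hF : F.IsWeakEquivalence) {A : K} {J : SSet.{v}}
    {d : ⊤_ K ⟶ cotensor A J} {l : ⊤_ K ⟶ A} :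
    IsColimitElement (F.mapDiagram d) (F.mapElement l) ↔ IsColimitElement d l := by
  rw [isColimitElement_iff, isColimitElement_iff, mapDiagram, mapElement, mapElement,
    ← map_constDiagram, hoMap_comp, hoMap_comp (_ ≫ _) (F.cotensorComparison A J),
    ← isAbsLeftLift_postcomp_iff, isAbsLeftLift_precomp_iff]
  -- the comparisons `F (A^J) ≅ (F A)^J` and `1 ≅ F 1` have been cancelled
  exact hF.isBiequivalence.isAbsLeftLift_map_iff (f := hoMap (constDiagram A J)) (g := hoMap d)
    (l := hoMap l)

theorem exists_mapElement_iso (hF : F.IsWeakEquivalence) {A : K}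
    (l : ⊤_ L ⟶ F.functor.obj A) :
    ∃ l' : ⊤_ K ⟶ A, Nonempty (hoMap (F.mapElement l') ≅ hoMap l) := by
  obtain ⟨l', ⟨i⟩⟩ := exists_map_iso hF ((PreservesTerminal.iso F.functor).hom ≫ l)
  refine ⟨l', ⟨Bicategory.whiskerLeftIso (hoMap (PreservesTerminal.iso F.functor).inv) i ≪≫
    eqToIso (congrArg hoMap (Iso.inv_hom_id_assoc (PreservesTerminal.iso F.functor) l))⟩⟩

theorem isAdjoint_map_iff (hF : F.IsWeakEquivalence) {A B : K} {f : B ⟶ A} {u : A ⟶ B} :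
    IsAdjoint (F.functor.map f) (F.functor.map u) ↔ IsAdjoint f u :=
  hF.isBiequivalence.nonempty_adjunction_map_iff (f := hoMap f) (u := hoMap u)

end CosmosFunctor

end

end Cosmos

end

theorem mainTheorem1
    {K : Type u₁} [Category.{v} K] [SimplicialCategory K] [Cosmos.InfinityCosmos K]
    {L : Type u₂} [Category.{v} L] [SimplicialCategory L] [Cosmos.InfinityCosmos L]
    (F : Cosmos.CosmosFunctor K L) (hF : F.IsWeakEquivalence) :
    -- adjointness of a pair of functors
    (∀ (A B : K) (f : B ⟶ A) (u : A ⟶ B),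
      Cosmos.IsAdjoint f u ↔ Cosmos.IsAdjoint (F.functor.map f) (F.functor.map u)) ∧
    -- existence of a left adjoint
    (∀ (A B : K) (u : A ⟶ B),
      (∃ f : B ⟶ A, Cosmos.IsAdjoint f u) ↔
        ∃ f : F.functor.obj B ⟶ F.functor.obj A, Cosmos.IsAdjoint f (F.functor.map u)) ∧
    -- existence of a right adjoint
    (∀ (A B : K) (u : A ⟶ B),
      (∃ r : B ⟶ A, Cosmos.IsAdjoint u r) ↔
        ∃ r : F.functor.obj B ⟶ F.functor.obj A, Cosmos.IsAdjoint (F.functor.map u) r) ∧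
    -- a given element is a limit of a given diagram
    (∀ (A : K) (J : SSet.{v}) (d : ⊤_ K ⟶ Cosmos.cotensor A J) (l : ⊤_ K ⟶ A),
      Cosmos.IsLimitElement d l ↔ Cosmos.IsLimitElement (F.mapDiagram d) (F.mapElement l)) ∧
    -- a given element is a colimit of a given diagram
    (∀ (A : K) (J : SSet.{v}) (d : ⊤_ K ⟶ Cosmos.cotensor A J) (l : ⊤_ K ⟶ A),
      Cosmos.IsColimitElement d l ↔ Cosmos.IsColimitElement (F.mapDiagram d) (F.mapElement l)) ∧
    -- existence of a limit of a given diagram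
    (∀ (A : K) (J : SSet.{v}) (d : ⊤_ K ⟶ Cosmos.cotensor A J),
      (∃ l : ⊤_ K ⟶ A, Cosmos.IsLimitElement d l) ↔
        ∃ l : ⊤_ L ⟶ F.functor.obj A, Cosmos.IsLimitElement (F.mapDiagram d) l) ∧
    -- existence of a colimit of a given diagram
    (∀ (A : K) (J : SSet.{v}) (d : ⊤_ K ⟶ Cosmos.cotensor A J),
      (∃ l : ⊤_ K ⟶ A, Cosmos.IsColimitElement d l) ↔
        ∃ l : ⊤_ L ⟶ F.functor.obj A, Cosmos.IsColimitElement (F.mapDiagram d) l) := by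
  refine ⟨fun A B f u => (Cosmos.CosmosFunctor.isAdjoint_map_iff hF).symm,
    fun A B u => ⟨fun ⟨f, h⟩ => ⟨_, (Cosmos.CosmosFunctor.isAdjoint_map_iff hF).2 h⟩, ?_⟩,
    fun A B u => ⟨fun ⟨r, h⟩ => ⟨_, (Cosmos.CosmosFunctor.isAdjoint_map_iff hF).2 h⟩, ?_⟩,
    fun A J d l => (Cosmos.CosmosFunctor.isLimitElement_map_iff hF).symm,
    fun A J d l => (Cosmos.CosmosFunctor.isColimitElement_map_iff hF).symm,
    fun A J d => ⟨fun ⟨l, h⟩ => ⟨_, (Cosmos.CosmosFunctor.isLimitElement_map_iff hF).2 h⟩, ?_⟩,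
    fun A J d => ⟨fun ⟨l, h⟩ => ⟨_, (Cosmos.CosmosFunctor.isColimitElement_map_iff hF).2 h⟩, ?_⟩⟩
  · rintro ⟨f, h⟩
    obtain ⟨f', ⟨i⟩⟩ := Cosmos.CosmosFunctor.exists_map_iso hF f
    exact ⟨f', (Cosmos.CosmosFunctor.isAdjoint_map_iff hF).1
      (Cosmos.nonempty_adjunction_congr i.symm (Iso.refl _) h)⟩
  · rintro ⟨r, h⟩
    obtain ⟨r', ⟨i⟩⟩ := Cosmos.CosmosFunctor.exists_map_iso hF r
    exact ⟨r', (Cosmos.CosmosFunctor.isAdjoint_map_iff hF).1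
      (Cosmos.nonempty_adjunction_congr (Iso.refl _) i.symm h)⟩
  · rintro ⟨l, h⟩
    obtain ⟨l', ⟨i⟩⟩ := Cosmos.CosmosFunctor.exists_mapElement_iso hF l
    refine ⟨l', (Cosmos.CosmosFunctor.isLimitElement_map_iff hF).1 ?_⟩
    rw [Cosmos.isLimitElement_iff] at h ⊢
    exact Cosmos.isAbsRightLift_congr (Iso.refl _) (Iso.refl _) i.symm h
  · rintro ⟨l, h⟩
    obtain ⟨l', ⟨i⟩⟩ := Cosmos.CosmosFunctor.exists_mapElement_iso hF l
    refine ⟨l', (Cosmos.CosmosFunctor.isColimitElement_map_iff hF).1 ?_⟩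
    rw [Cosmos.isColimitElement_iff] at h ⊢
    exact Cosmos.isAbsLeftLift_congr (Iso.refl _) (Iso.refl _) i.symm h
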